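/- Let $A$ be a finite dimensional algebra over a field, and let $\operatorname{mod} A$ be the category of finite dimensional (equivalently, finitely generated) left $A$-modules. All subcategories are full and closed under isomorphisms. Let $K^b(A)$ be the bounded homotopy category of complexes of projective objects of $\operatorname{mod} A$, with shift $[1]$ and its usual triangulated structure, and let $\mathbf{E}\subset K^b(A)$ be the two-term category of $A$, i.e. the full subcategory of objects isomorphic to complexes concentrated in degrees $-1$ and $0$. A pair $(\mathbf{U},\mathbf{V})$ of subcategories of $\mathbf{E}$ is a complete cotorsion pair in $\mathbf{E}$ if: (i) for every $X\in\mathbf{E}$: $\operatorname{Hom}(U,X[1])=0$ for all $U\in\mathbf{U}$ if and only if $X\in\mathbf{V}$; and $\operatorname{Hom}(X,V[1])=0$ for all $V\in\mathbf{V}$ if and only if $X\in\mathbf{U}$; (ii) for every $X\in\mathbf{E}$ there are triangles $V\to U\to X\to V[1]$ and $X\to V'\to U'\to X[1]$ with $U,U'\in\mathbf{U}$ and $V,V'\in\mathbf{V}$. For a subcategory $\mathbf{W}$ of $\mathbf{E}$, let $H^0(\mathbf{W})$ be the subcategory of $\operatorname{mod} A$ of modules isomorphic to $H^0(W)$ for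 some $W\in\mathbf{W}$. Let $(\mathbf{U},\mathbf{V})$ be a complete cotorsion pair in $\mathbf{E}$, and put $\mathcal{C}=H^0(\mathbf{U})$, $\mathcal{T}=H^0(\mathbf{V})$. Then $(\mathcal{C},\mathcal{T})$ is a left weak cotorsion pair in $\operatorname{mod} A$, that is: (1) $\operatorname{Ext}^1_A(X,Y)=0$ for all $X\in\mathcal{C}$ and $Y\in\mathcal{T}$; (2) for every $M\in\operatorname{mod} A$ there are exact sequences $$0\to Y_M\to X_M\xrightarrow{f_M} M\to 0\quad\text{and}\quad M\xrightarrow{g^M} Y^M\to X^M\to 0$$ with $X_M,X^M\in\mathcal{C}$ and $Y_M,Y^M\in\mathcal{T}$, such that $f_M$ is a right $\mathcal{C}$-approximation of $M$ (every morphism $X\to M$ with $X\in\mathcal{C}$ factors through $f_M$) and $g^M$ is a left $\mathcal{T}$-approximation of $M$ (every morphism $M\to Y$ with $Y\in\mathcal{T}$ factors through $g^M$). -/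

import Mathlib

open CategoryTheory CategoryTheory.Limits CategoryTheory.Pretriangulated

universe u v w

namespace TwoTermCotorsion

section Extriangulated

variable {T : Type u} [Category.{v} T] [Preadditive T] [HasZeroObject T] [HasShift T ℤ]
  [∀ n : ℤ, (shiftFunctor T n).Additive] [Pretriangulated T]

/-- `𝔼(X, Y) = Hom(X, Y[1])` vanishes. -/
def EVanishes (X Y : T) : Prop := ∀ f : X ⟶ Y⟦(1 : ℤ)⟧, f = 0

/-- Full subcategories `U`, `V` of the full (extension-closed) subcategory `E` of the
triangulated category `T` form a cotorsion pair in the extriangulated category `E`.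
Both are automatically closed under isomorphisms when `E` is. -/
structure IsCotorsionPair (E U V : ObjectProperty T) : Prop where
  left_le : U ≤ E
  right_le : V ≤ E
  right_iff : ∀ X, E X → ((∀ W, U W → EVanishes W X) ↔ V X)
  left_iff : ∀ X, E X → ((∀ W, V W → EVanishes X W) ↔ U X)

/-- `Cone(V, U)`: the objects `X` of `E` in a triangle `V' ⟶ U' ⟶ X ⟶ V'[1]` of objects of `E`
with `V'` in `V` and `U'` in `U`. -/
def cone (E V U : ObjectProperty T) : ObjectProperty T := fun X =>
  E X ∧ ∃ (V' U' : T) (f : V' ⟶ U') (g : U' ⟶ X) (h : X ⟶ V'⟦(1 : ℤ)⟧),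
    E V' ∧ E U' ∧ V V' ∧ U U' ∧ Triangle.mk f g h ∈ distTriang T

/-- `Cocone(V, U)`: the objects `X` of `E` in a triangle `X ⟶ V' ⟶ U' ⟶ X[1]` of objects of `E`
with `V'` in `V` and `U'` in `U`. -/
def cocone (E V U : ObjectProperty T) : ObjectProperty T := fun X =>
  E X ∧ ∃ (V' U' : T) (f : X ⟶ V') (g : V' ⟶ U') (h : U' ⟶ X⟦(1 : ℤ)⟧),
    E V' ∧ E U' ∧ V V' ∧ U U' ∧ Triangle.mk f g h ∈ distTriang T

/-- A complete cotorsion pair `(U, V)` in `E`: moreover `E = Cone(V, U) = Cocone(V, U)`. -/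
structure IsCompleteCotorsionPair (E U V : ObjectProperty T) : Prop
    extends IsCotorsionPair E U V where
  cone_eq : cone E V U = E
  cocone_eq : cocone E V U = E

end Extriangulated

section Approximation

variable {C : Type u} [Category.{v} C]

/-- `f : X ⟶ M` is a right `P`-approximation of `M`. -/
def IsRightApproximation (P : ObjectProperty C) {X M : C} (f : X ⟶ M) : Prop :=
  P X ∧ ∀ (X' : C), P X' → ∀ h : X' ⟶ M, ∃ l : X' ⟶ X, l ≫ f = h

/-- `g : M ⟶ Y` is a left `P`-approximation of `M`. -/
def IsLeftApproximation (P : ObjectProperty C) {M Y : C} (g : M ⟶ Y) : Prop :=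
  P Y ∧ ∀ (Y' : C), P Y' → ∀ h : M ⟶ Y', ∃ l : Y ⟶ Y', g ≫ l = h

end Approximation

section Modules

variable (A : Type u) [Ring A]

/-- The homotopy category of cochain complexes of left `A`-modules. -/
abbrev K : Type (u + 1) := HomotopyCategory (ModuleCat.{u} A) (ComplexShape.up ℤ)

/-- The two-term category of `A`: the full subcategory of the homotopy category whose objects are
(up to isomorphism) the complexes of finitely generated projective modules concentrated
in degrees `-1` and `0`. -/
def twoTerm : ObjectProperty (K A) := fun X =>
  ∃ P : CochainComplex (ModuleCat.{u} A) ℤ,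
    (∀ i, ModuleCat.isFG A (P.X i) ∧ Projective (P.X i)) ∧
    (∀ i, i ≠ -1 → i ≠ 0 → IsZero (P.X i)) ∧
    Nonempty (X ≅ (HomotopyCategory.quotient (ModuleCat.{u} A) (ComplexShape.up ℤ)).obj P)

variable {A}

/-- `H⁰(U)`: the full subcategory of modules isomorphic to `H⁰(X)` for some `X` in `U`. -/
noncomputable def H0 (U : ObjectProperty (K A)) : ObjectProperty (ModuleCat.{u} A) :=
  U.map (HomotopyCategory.homologyFunctor (ModuleCat.{u} A) (ComplexShape.up ℤ) 0)

/-- A left weak cotorsion pair `(C, T)` in `mod A`, the full subcategory of finitely generated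
left `A`-modules. -/
structure IsLeftWeakCotorsionPair (C T : ObjectProperty (ModuleCat.{u} A)) : Prop where
  left_le : C ≤ ModuleCat.isFG A
  right_le : T ≤ ModuleCat.isFG A
  left_iso : C.IsClosedUnderIsomorphisms
  right_iso : T.IsClosedUnderIsomorphisms
  ext_eq_zero : ∀ X Y, C X → T Y → ∀ e : Abelian.Ext X Y 1, e = 0
  /-- `0 ⟶ Y ⟶ X ⟶ M ⟶ 0` -/
  exists_right : ∀ M, ModuleCat.isFG A M →
    ∃ (Y X : ModuleCat.{u} A) (i : Y ⟶ X) (f : X ⟶ M) (zero : i ≫ f = 0),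
      C X ∧ T Y ∧ (ShortComplex.mk i f zero).ShortExact ∧ IsRightApproximation C f
  /-- `M ⟶ Y ⟶ X ⟶ 0` -/
  exists_left : ∀ M, ModuleCat.isFG A M →
    ∃ (Y X : ModuleCat.{u} A) (g : M ⟶ Y) (p : Y ⟶ X) (zero : g ≫ p = 0),
      C X ∧ T Y ∧ (ShortComplex.mk g p zero).Exact ∧ Epi p ∧ IsLeftApproximation T g

end Modules

end TwoTermCotorsion

namespace TwoTermCotorsion

open CochainComplex.HomComplex

/-! Everything rests on a criterion (`eVanishes_iff`): for two-term complexes of projectives, `𝔼(P,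
Q) = 0` exactly when every map `P⁻¹ ⟶ H⁰(Q)` extends along `d` to `P⁰`. So `𝔼(P, Q) = 0` depends on
`Q` only through `H⁰(Q)` and, as `P⁻¹` is projective, passes to quotients of `H⁰(Q)`; hence `H⁰(V)`
is closed under quotients. The criterion also forces `Ext¹(H⁰(P), H⁰(Q)) = 0`, since `P⁻¹` covers
the kernel of `P⁰ ⟶ H⁰(P)`.

Given `M = H⁰(P)`, apply `H⁰` to the two triangles of `P`. Since `H⁰` kills shifts of two-term
complexes, both sequences end in an epimorphism. In the first, the kernel of `H⁰(U') ⟶ M` is a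
quotient of `H⁰(V')`, hence lies in `H⁰(V)`, and `Ext¹`-vanishing makes the map a right
approximation. In the second, `H⁰` is full on two-term complexes, so a map `M ⟶ H⁰(Y)` with `Y` in
`V` lifts to `P ⟶ Y`, which extends to `V'` because `𝔼(U', Y) = 0`. -/

lemma EVanishes.of_iso {T : Type u} [Category.{v} T] [Preadditive T] [HasShift T ℤ]
    {X X' Y Y' : T} (h : EVanishes X Y) (e : X ≅ X') (e' : Y ≅ Y') : EVanishes X' Y' := fun f => by
  have := h (e.hom ≫ f ≫ e'.inv⟦(1 : ℤ)⟧')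
  rwa [Preadditive.IsIso.comp_left_eq_zero, Preadditive.IsIso.comp_right_eq_zero] at this

/-- If `𝔼(Z, Y)` vanishes, morphisms to `Y` extend along the first morphism of a triangle
`X ⟶ X' ⟶ Z ⟶ X[1]`. -/
lemma EVanishes.exists_extension {T : Type u} [Category.{v} T] [Preadditive T] [HasZeroObject T]
    [HasShift T ℤ] [∀ n : ℤ, (shiftFunctor T n).Additive] [Pretriangulated T]
    {X X' Z Y : T} (h : EVanishes Z Y) {f : X ⟶ X'} {g : X' ⟶ Z}
    {δ : Z ⟶ X⟦(1 : ℤ)⟧} (hT : Triangle.mk f g δ ∈ distTriang T) (a : X ⟶ Y) :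
    ∃ b : X' ⟶ Y, f ≫ b = a := by
  -- The composite `Z ⟶ X[1] ⟶ Y[1]` vanishes by hypothesis, so `a[1]` factors through the next map
  -- of the rotated triangle, which is `-f[1]`; hence the sign in the witness `-c`.
  obtain ⟨b, hb⟩ : ∃ b : X'⟦(1 : ℤ)⟧ ⟶ Y⟦(1 : ℤ)⟧, a⟦(1 : ℤ)⟧' = (-f⟦(1 : ℤ)⟧') ≫ b :=
    Triangle.yoneda_exact₃ _ (rot_of_distTriang _ hT) (a⟦(1 : ℤ)⟧') (h (δ ≫ a⟦(1 : ℤ)⟧'))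
  obtain ⟨c, rfl⟩ := (shiftFunctor T (1 : ℤ)).map_surjective b
  refine ⟨-c, (shiftFunctor T (1 : ℤ)).map_injective ?_⟩
  simp [hb]

/-! ### Two-term complexes of projectives in an abelian category -/

section

variable {C : Type u} [Category.{v} C] [Abelian C]

/-- A complex of projective objects concentrated in degrees `-1` and `0`. -/
structure IsTwoTermProjective (P : CochainComplex C ℤ) : Prop where
  projective (i : ℤ) : Projective (P.X i)
  isZero (i : ℤ) (h : i ≠ -1) (h' : i ≠ 0) : IsZero (P.X i)

variable {P Q : CochainComplex C ℤ}

lemma IsTwoTermProjective.d_zero_one (hP : IsTwoTermProjective P) : P.d 0 1 = 0 :=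
  (hP.isZero 1 (by simp) (by simp)).eq_of_tgt _ _

/-- `P⁰ / im d⁻¹` is `H⁰(P)` when `d⁰ = 0`. -/
noncomputable def opcyclesIsoH0 (P : CochainComplex C ℤ) (hP : P.d 0 1 = 0) :
    P.opcycles 0 ≅ (HomotopyCategory.homologyFunctor C (.up ℤ) 0).obj
      ((HomotopyCategory.quotient C (.up ℤ)).obj P) :=
  haveI := P.isIso_homologyι 0 1 (by simp) hP
  (asIso (P.homologyι 0)).symm ≪≫
    ((HomotopyCategory.homologyFunctorFactors C (.up ℤ) 0).app P).symm

lemma opcyclesIsoH0_naturality (hP : P.d 0 1 = 0) (hQ : Q.d 0 1 = 0) (f : P ⟶ Q) :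
    (opcyclesIsoH0 P hP).hom ≫ (HomotopyCategory.homologyFunctor C (.up ℤ) 0).map
      ((HomotopyCategory.quotient C (.up ℤ)).map f) =
    HomologicalComplex.opcyclesMap f 0 ≫ (opcyclesIsoH0 Q hQ).hom := by
  have h := (HomotopyCategory.homologyFunctorFactors C (.up ℤ) 0).inv.naturality f
  have h' := HomologicalComplex.homologyι_naturality f 0
  have := P.isIso_homologyι 0 1 (by simp) hP
  have := Q.isIso_homologyι 0 1 (by simp) hQ
  rw [← cancel_epi (P.homologyι 0), ← reassoc_of% h']
  have e {R : CochainComplex C ℤ} (hR : R.d 0 1 = 0) :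
      R.homologyι 0 ≫ (opcyclesIsoH0 R hR).hom =
        (HomotopyCategory.homologyFunctorFactors C (.up ℤ) 0).inv.app R := by
    have := R.isIso_homologyι 0 1 (by simp) hR
    exact IsIso.hom_inv_id_assoc (R.homologyι 0) _
  rw [reassoc_of% (e hP), e hQ]
  exact h.symm

/-- The canonical projection `P⁰ ⟶ H⁰(P)` when `d⁰ = 0`. -/
noncomputable def toH0 (P : CochainComplex C ℤ) (hP : P.d 0 1 = 0) :
    P.X 0 ⟶ (HomotopyCategory.homologyFunctor C (.up ℤ) 0).obj
      ((HomotopyCategory.quotient C (.up ℤ)).obj P) :=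
  P.pOpcycles 0 ≫ (opcyclesIsoH0 P hP).hom

instance (hP : P.d 0 1 = 0) : Epi (toH0 P hP) := by
  dsimp only [toH0]
  infer_instance

lemma d_toH0 (hP : P.d 0 1 = 0) : P.d (-1) 0 ≫ toH0 P hP = 0 := by
  simp [toH0]

lemma toH0_exact (hP : P.d 0 1 = 0) :
    (ShortComplex.mk _ _ (d_toH0 hP)).Exact := by
  have h := ShortComplex.exact_of_g_is_cokernel (ShortComplex.mk _ _ (P.d_pOpcycles (-1) 0))
    (P.opcyclesIsCokernel (-1) 0 (by simp))
  let e : ShortComplex.mk _ _ (P.d_pOpcycles (-1) 0) ≅ ShortComplex.mk _ _ (d_toH0 hP) :=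
    ShortComplex.isoMk (Iso.refl _) (Iso.refl _) (opcyclesIsoH0 P hP)
      (by simp) (by simp [toH0])
  exact (ShortComplex.exact_iff_of_iso e).1 h

lemma toH0_naturality (hP : P.d 0 1 = 0) (hQ : Q.d 0 1 = 0) (f : P ⟶ Q) :
    toH0 P hP ≫ (HomotopyCategory.homologyFunctor C (.up ℤ) 0).map
      ((HomotopyCategory.quotient C (.up ℤ)).map f) = f.f 0 ≫ toH0 Q hQ := by
  simp [toH0, opcyclesIsoH0_naturality hP hQ]

/-- A morphism `H⁰(P) ⟶ H⁰(Q)` lifts to the complexes. -/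
lemma exists_map_eq (hP : IsTwoTermProjective P) (hQ : IsTwoTermProjective Q)
    (φ : (HomotopyCategory.homologyFunctor C (.up ℤ) 0).obj
        ((HomotopyCategory.quotient C (.up ℤ)).obj P) ⟶
      (HomotopyCategory.homologyFunctor C (.up ℤ) 0).obj
        ((HomotopyCategory.quotient C (.up ℤ)).obj Q)) :
    ∃ f : (HomotopyCategory.quotient C (.up ℤ)).obj P ⟶
        (HomotopyCategory.quotient C (.up ℤ)).obj Q,
      (HomotopyCategory.homologyFunctor C (.up ℤ) 0).map f = φ := by
  have := hP.projective
  let f₀ : P.X 0 ⟶ Q.X 0 :=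
    Projective.factorThru (toH0 P hP.d_zero_one ≫ φ) (toH0 Q hQ.d_zero_one)
  have hf₀ : f₀ ≫ toH0 Q hQ.d_zero_one = toH0 P hP.d_zero_one ≫ φ :=
    Projective.factorThru_comp _ _
  let f₁ : P.X (-1) ⟶ Q.X (-1) := (toH0_exact hQ.d_zero_one).liftFromProjective
    (P.d (-1) 0 ≫ f₀) (by simp [hf₀, reassoc_of% (d_toH0 hP.d_zero_one)])
  have hf₁ : f₁ ≫ Q.d (-1) 0 = P.d (-1) 0 ≫ f₀ :=
    (toH0_exact hQ.d_zero_one).liftFromProjective_comp _ _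
  -- The chain map has components `f₁` and `f₀` only; its sole nontrivial commutativity condition is
  -- the square from degree `-1` to `0`.
  let z : Cocycle P Q 0 := Cocycle.mk (Cochain.single f₁ 0 + Cochain.single f₀ 0) 1 (by simp) (by
    ext p q hpq
    by_cases hp : p = -1
    · obtain rfl := hp
      obtain rfl : q = 0 := by lia
      rw [δ_zero_cochain_v]
      simp only [Cochain.add_v, Cochain.single_v, Cochain.zero_v,
        Cochain.single_v_eq_zero f₀ 0 (-1) (-1) (by simp) (by simp),
        Cochain.single_v_eq_zero f₁ 0 0 0 (by simp) (by simp)]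
      simp [hf₁]
    · by_cases hp' : p = 0
      · obtain rfl := hp'
        exact (hQ.isZero q (by lia) (by lia)).eq_of_tgt _ _
      · exact (hP.isZero p hp hp').eq_of_src _ _)
  refine ⟨(HomotopyCategory.quotient C (.up ℤ)).map (Cocycle.homOf z), ?_⟩
  rw [← cancel_epi (toH0 P hP.d_zero_one), toH0_naturality hP.d_zero_one hQ.d_zero_one, ← hf₀]
  congr 1
  simp [z, Cochain.single_v_eq_zero f₁ 0 0 0 (by simp) (by simp)]

/-- Morphisms `P ⟶ Q[1]` up to homotopy are degree `1` cocycles modulo coboundaries. -/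
lemma eVanishes_iff_forall_cocycle :
    EVanishes ((HomotopyCategory.quotient C (.up ℤ)).obj P)
      ((HomotopyCategory.quotient C (.up ℤ)).obj Q) ↔
      ∀ z : Cocycle P Q 1, ∃ β : Cochain P Q 0, δ 0 1 β = z := by
  let e := ((HomotopyCategory.quotient C (.up ℤ)).commShiftIso (1 : ℤ)).app Q
  have h (z : Cocycle P Q 1) :
    CohomologyClass.toHom (CohomologyClass.mk z) = 0 ↔ ∃ β : Cochain P Q 0, δ 0 1 β = z := by
    rw [CohomologyClass.toHom_mk_eq_zero_iff, mem_coboundaries_iff _ 0 (by simp)]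
  constructor
  · intro H z
    rw [← h, ← cancel_mono e.hom, zero_comp]
    exact H _
  · intro H f
    obtain ⟨c, hc⟩ := (CohomologyClass.toHom_bijective P Q 1).2 (f ≫ e.inv)
    obtain ⟨z, rfl⟩ := c.mk_surjective
    rw [(h z).2 (H z)] at hc
    rw [← cancel_mono e.inv, zero_comp]
    exact hc.symm

/-- `𝔼(P, Q)` vanishes if and only if all morphisms `P⁻¹ ⟶ H⁰(Q)` extend to `P⁰`. -/
lemma eVanishes_iff (hP : IsTwoTermProjective P) (hQ : IsTwoTermProjective Q) :
    EVanishes ((HomotopyCategory.quotient C (.up ℤ)).obj P)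
      ((HomotopyCategory.quotient C (.up ℤ)).obj Q) ↔
      ∀ φ : P.X (-1) ⟶ (HomotopyCategory.homologyFunctor C (.up ℤ) 0).obj
        ((HomotopyCategory.quotient C (.up ℤ)).obj Q), ∃ g, P.d (-1) 0 ≫ g = φ := by
  have := hP.projective
  -- For support reasons, only the component `P⁻¹ ⟶ Q⁰` of a degree `1` cochain can be nonzero.
  have hext {z z' : Cochain P Q 1} (h : z.v (-1) 0 (by simp) = z'.v (-1) 0 (by simp)) :
      z = z' := by
    ext p q hpq
    by_cases hp : p = -1
    · obtain rfl := hp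
      obtain rfl : q = 0 := by lia
      exact h
    · by_cases hp' : p = 0
      · exact (hQ.isZero q (by lia) (by lia)).eq_of_tgt _ _
      · exact (hP.isZero p hp hp').eq_of_src _ _
  rw [eVanishes_iff_forall_cocycle]
  constructor
  · intro H φ
    let φ' := Projective.factorThru φ (toH0 Q hQ.d_zero_one)
    have hφ' : φ' ≫ toH0 Q hQ.d_zero_one = φ := Projective.factorThru_comp _ _
    let z : Cocycle P Q 1 := Cocycle.mk (Cochain.single φ' 1) 2 (by simp) (by
      ext p q hpq
      by_cases hp : p = -1 ∨ p = 0
      · exact (hQ.isZero q (by lia) (by lia)).eq_of_tgt _ _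
      · exact (hP.isZero p (by tauto) (by tauto)).eq_of_src _ _)
    obtain ⟨β, hβ⟩ := H z
    have hv := Cochain.congr_v hβ (-1) 0 (by simp)
    rw [δ_zero_cochain_v] at hv
    simp only [z, Cocycle.mk_coe, Cochain.single_v] at hv
    -- Here `φ' = β⁻¹ d - d β⁰`, and `β⁻¹ d` dies in `H⁰(Q)`.
    refine ⟨-(β.v 0 0 (by simp) ≫ toH0 Q hQ.d_zero_one), ?_⟩
    rw [← hφ', ← hv]
    simp [d_toH0]
  · intro H z
    obtain ⟨g, hg⟩ := H (z.1.v (-1) 0 (by simp) ≫ toH0 Q hQ.d_zero_one)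
    let g' := Projective.factorThru g (toH0 Q hQ.d_zero_one)
    have hg' : g' ≫ toH0 Q hQ.d_zero_one = g := Projective.factorThru_comp _ _
    let f : P.X (-1) ⟶ Q.X (-1) := (toH0_exact hQ.d_zero_one).liftFromProjective
      (z.1.v (-1) 0 (by simp) - P.d (-1) 0 ≫ g') (by simp [hg', hg])
    have hf : f ≫ Q.d (-1) 0 = z.1.v (-1) 0 (by simp) - P.d (-1) 0 ≫ g' :=
      (toH0_exact hQ.d_zero_one).liftFromProjective_comp _ _
    refine ⟨Cochain.single f 0 - Cochain.single g' 0, hext ?_⟩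
    rw [δ_zero_cochain_v]
    simp only [Cochain.sub_v, Cochain.single_v,
        Cochain.single_v_eq_zero g' 0 (-1) (-1) (by simp) (by simp),
        Cochain.single_v_eq_zero f 0 0 0 (by simp) (by simp)]
    simp [hf]

/-- `Ext¹(H⁰(P), N)` vanishes when all morphisms `P⁻¹ ⟶ N` extend to `P⁰`. -/
lemma ext_eq_zero_of_forall_exists [HasExt.{w} C] (hP : IsTwoTermProjective P) {N : C}
    (H : ∀ φ : P.X (-1) ⟶ N, ∃ g, P.d (-1) 0 ≫ g = φ)
    (e : Abelian.Ext ((HomotopyCategory.homologyFunctor C (.up ℤ) 0).obj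
        ((HomotopyCategory.quotient C (.up ℤ)).obj P)) N 1) : e = 0 := by
  have := hP.projective
  let π := toH0 P hP.d_zero_one
  let S : ShortComplex C := ShortComplex.mk (kernel.ι π) π (kernel.condition π)
  have hS : S.ShortExact :=
    { exact := ShortComplex.exact_of_f_is_kernel _ (kernelIsKernel π) }
  -- As `P⁰` is projective, `e` is the image of some `a : ker π ⟶ N` under the connecting map; it
  -- vanishes once `a` extends to `P⁰`. This can be tested after composing with the epimorphism `P⁻¹
  -- ⟶ ker π`.
  obtain ⟨x, hx⟩ := Abelian.Ext.contravariant_sequence_exact₃ hS N e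
    (Abelian.Ext.eq_zero_of_projective (P := P.X 0) _) (n₀ := 0) (by simp)
  obtain ⟨a, rfl⟩ := Abelian.Ext.addEquiv₀.symm.surjective x
  have hepi : Epi (kernel.lift π (P.d (-1) 0) (d_toH0 hP.d_zero_one)) :=
    (toH0_exact hP.d_zero_one).epi_kernelLift
  obtain ⟨g, hg⟩ := H (kernel.lift π (P.d (-1) 0) (d_toH0 hP.d_zero_one) ≫ a)
  have ha : a = S.f ≫ g := by
    rw [← cancel_epi (kernel.lift π (P.d (-1) 0) (d_toH0 hP.d_zero_one)), ← hg]
    simp [S]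
  rw [← hx, ha]
  simp [← Abelian.Ext.mk₀_comp_mk₀]

/-- The degree `0` term of `P[1]` is `P¹ = 0`. -/
lemma isZero_H0_shift (hP : IsTwoTermProjective P) :
    IsZero ((HomotopyCategory.homologyFunctor C (.up ℤ) 0).obj
      (((HomotopyCategory.quotient C (.up ℤ)).obj P)⟦(1 : ℤ)⟧)) := by
  let e := ((HomotopyCategory.quotient C (.up ℤ)).commShiftIso (1 : ℤ)).app P
  refine IsZero.of_iso ?_ ((HomotopyCategory.homologyFunctor C (.up ℤ) 0).mapIso e.symm ≪≫
    (HomotopyCategory.homologyFunctorFactors C (.up ℤ) 0).app (P⟦(1 : ℤ)⟧))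
  refine ShortComplex.isZero_homology_of_isZero_X₂ _ ?_
  exact hP.isZero _ (by simp) (by simp)

end

/-! ### Finitely generated modules and the two-term category -/

section

variable {A : Type u} [Ring A]

lemma isFG_of_epi {M N : ModuleCat.{u} A} (f : M ⟶ N) [Epi f] (hM : ModuleCat.isFG A M) :
    ModuleCat.isFG A N := by
  rw [ModuleCat.isFG_iff] at hM ⊢
  exact Module.Finite.of_surjective f.hom ((ModuleCat.epi_iff_surjective f).1 inferInstance)

lemma exists_epi_from_projective {M : ModuleCat.{u} A} (hM : ModuleCat.isFG A M) :
    ∃ (P : ModuleCat.{u} A) (f : P ⟶ M), ModuleCat.isFG A P ∧ Projective P ∧ Epi f := by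
  rw [ModuleCat.isFG_iff] at hM
  obtain ⟨n, f, hf⟩ := Module.Finite.exists_fin' A M
  refine ⟨ModuleCat.of A (Fin n → A), ModuleCat.ofHom f, ?_, ?_,
    (ModuleCat.epi_iff_surjective _).2 hf⟩
  · rw [ModuleCat.isFG_iff]
    exact inferInstanceAs (Module.Finite A (Fin n → A))
  · exact (IsProjective.iff_projective (Fin n → A)).1 inferInstance

lemma twoTerm_quotient {P : CochainComplex (ModuleCat.{u} A) ℤ}
    (hP : IsTwoTermProjective P) (hP' : ∀ i, ModuleCat.isFG A (P.X i)) :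
    twoTerm A ((HomotopyCategory.quotient _ _).obj P) :=
  ⟨P, fun i => ⟨hP' i, hP.projective i⟩, hP.isZero, ⟨Iso.refl _⟩⟩

/-- Finitely generated modules over a noetherian ring are `H⁰` of two-term complexes. -/
lemma exists_presentation [IsNoetherianRing A] {M : ModuleCat.{u} A} (hM : ModuleCat.isFG A M) :
    ∃ P : CochainComplex (ModuleCat.{u} A) ℤ, IsTwoTermProjective P ∧
      (∀ i, ModuleCat.isFG A (P.X i)) ∧
      Nonempty ((HomotopyCategory.homologyFunctor (ModuleCat.{u} A) (.up ℤ) 0).obj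
        ((HomotopyCategory.quotient _ (.up ℤ)).obj P) ≅ M) := by
  obtain ⟨P₀, p, hP₀, hP₀', hp⟩ := exists_epi_from_projective hM
  have hK : ModuleCat.isFG A (kernel p) := by
    rw [ModuleCat.isFG_iff] at hP₀ ⊢
    exact Module.Finite.of_injective (kernel.ι p).hom
      ((ModuleCat.mono_iff_injective _).1 inferInstance)
  obtain ⟨P₁, q, hP₁, hP₁', hq⟩ := exists_epi_from_projective hK
  have h01 : (ComplexShape.up ℤ).Rel (-1) 0 := by simp
  let d := q ≫ kernel.ι p
  let P := HomologicalComplex.double d h01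
  let e₁ : P.X (-1) ≅ P₁ := HomologicalComplex.doubleXIso₀ d h01
  let e₀ : P.X 0 ≅ P₀ := HomologicalComplex.doubleXIso₁ d h01 (by simp)
  have hd : P.d (-1) 0 = e₁.hom ≫ d ≫ e₀.inv := HomologicalComplex.double_d d h01 (by simp)
  have hz (i : ℤ) (h : i ≠ -1) (h' : i ≠ 0) : IsZero (P.X i) :=
    HomologicalComplex.isZero_double_X d h01 i h h'
  have hP : IsTwoTermProjective P := by
    refine ⟨fun i => ?_, hz⟩
    by_cases h : i = -1
    · subst h
      exact Projective.of_iso e₁.symm hP₁'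
    · by_cases h' : i = 0
      · subst h'
        exact Projective.of_iso e₀.symm hP₀'
      · exact Projective.of_iso (hz i h h').isoZero.symm inferInstance
  refine ⟨P, hP, fun i => ?_, ?_⟩
  · by_cases h : i = -1
    · subst h
      exact isFG_of_epi e₁.inv hP₁
    · by_cases h' : i = 0
      · subst h'
        exact isFG_of_epi e₀.inv hP₀
      · have : Epi (0 : P₀ ⟶ P.X i) := ⟨fun _ _ _ => (hz i h h').eq_of_src _ _⟩
        exact isFG_of_epi (0 : P₀ ⟶ P.X i) hP₀
  -- Both `H⁰(P)` and `M` are cokernels of `P⁻¹ ⟶ P⁰`.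
  · have h₁ := (toH0_exact hP.d_zero_one).gIsCokernel
    have hdp : d ≫ p = 0 := by simp [d]
    have h₂ : (ShortComplex.mk d p hdp).Exact := by
      rw [ShortComplex.exact_iff_epi_kernel_lift]
      convert hq
      rw [← cancel_mono (kernel.ι p)]
      simp [d]
    let e : ShortComplex.mk d p hdp ≅
        ShortComplex.mk (P.d (-1) 0) (e₀.hom ≫ p) (by simp [hd, hdp]) :=
      ShortComplex.isoMk e₁.symm e₀.symm (Iso.refl _) (by simp [hd]) (by simp)
    have h₃ := (ShortComplex.exact_iff_of_iso e).1 h₂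
    have : Epi (e₀.hom ≫ p) := inferInstance
    exact ⟨h₁.coconePointUniqueUpToIso h₃.gIsCokernel⟩

lemma isFG_H0 {X : K A} (hX : twoTerm A X) :
    ModuleCat.isFG A
      ((HomotopyCategory.homologyFunctor (ModuleCat.{u} A) (.up ℤ) 0).obj X) := by
  obtain ⟨P, hP, hP', ⟨e⟩⟩ := hX
  have hP'' : IsTwoTermProjective P := ⟨fun i => (hP i).2, hP'⟩
  exact isFG_of_epi (toH0 P hP''.d_zero_one ≫
    (HomotopyCategory.homologyFunctor (ModuleCat.{u} A) (.up ℤ) 0).map e.inv) (hP 0).1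

lemma twoTerm.isZero_H0_shift {X : K A} (hX : twoTerm A X) :
    IsZero ((HomotopyCategory.homologyFunctor (ModuleCat.{u} A) (.up ℤ) 0).obj
      (X⟦(1 : ℤ)⟧)) := by
  obtain ⟨P, hP, hP', ⟨e⟩⟩ := hX
  exact IsZero.of_iso
    (TwoTermCotorsion.isZero_H0_shift (P := P) ⟨fun i => (hP i).2, hP'⟩)
    ((HomotopyCategory.homologyFunctor (ModuleCat.{u} A) (.up ℤ) 0).mapIso
      ((shiftFunctor (K A) (1 : ℤ)).mapIso e))

/-- The functor `H⁰` is full on two-term complexes. -/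
lemma twoTerm.exists_map_eq {X Y : K A} (hX : twoTerm A X) (hY : twoTerm A Y)
    (φ : (HomotopyCategory.homologyFunctor (ModuleCat.{u} A) (.up ℤ) 0).obj X ⟶
      (HomotopyCategory.homologyFunctor (ModuleCat.{u} A) (.up ℤ) 0).obj Y) :
    ∃ f : X ⟶ Y, (HomotopyCategory.homologyFunctor (ModuleCat.{u} A) (.up ℤ) 0).map f = φ := by
  obtain ⟨P, hP, hP', ⟨e⟩⟩ := hX
  obtain ⟨Q, hQ, hQ', ⟨e'⟩⟩ := hY
  obtain ⟨f, hf⟩ := TwoTermCotorsion.exists_map_eq (P := P) (Q := Q) ⟨fun i => (hP i).2, hP'⟩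
    ⟨fun i => (hQ i).2, hQ'⟩
    ((HomotopyCategory.homologyFunctor (ModuleCat.{u} A) (.up ℤ) 0).map e.inv ≫ φ ≫
      (HomotopyCategory.homologyFunctor (ModuleCat.{u} A) (.up ℤ) 0).map e'.hom)
  refine ⟨e.hom ≫ f ≫ e'.inv, ?_⟩
  rw [Functor.map_comp, Functor.map_comp, hf]
  simp

/-- `Ext¹(H⁰(X), H⁰(Y))` vanishes when `𝔼(X, Y)` does. -/
lemma EVanishes.ext_eq_zero {X Y : K A} (h : EVanishes X Y) (hX : twoTerm A X)
    (hY : twoTerm A Y) {M N : ModuleCat.{u} A}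
    (a : (HomotopyCategory.homologyFunctor (ModuleCat.{u} A) (.up ℤ) 0).obj X ≅ M)
    (b : (HomotopyCategory.homologyFunctor (ModuleCat.{u} A) (.up ℤ) 0).obj Y ≅ N)
    (e : Abelian.Ext M N 1) : e = 0 := by
  obtain ⟨P, hP, hP', ⟨i⟩⟩ := hX
  obtain ⟨Q, hQ, hQ', ⟨j⟩⟩ := hY
  have tP : IsTwoTermProjective P := ⟨fun i => (hP i).2, hP'⟩
  have tQ : IsTwoTermProjective Q := ⟨fun i => (hQ i).2, hQ'⟩
  have h' := (eVanishes_iff tP tQ).1 (h.of_iso i j)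
  let a' := (HomotopyCategory.homologyFunctor (ModuleCat.{u} A) (.up ℤ) 0).mapIso i.symm ≪≫ a
  let b' := (HomotopyCategory.homologyFunctor (ModuleCat.{u} A) (.up ℤ) 0).mapIso j.symm ≪≫ b
  have hz := ext_eq_zero_of_forall_exists tP (N := N) (fun φ => by
    obtain ⟨g, hg⟩ := h' (φ ≫ b'.inv)
    exact ⟨g ≫ b'.hom, by simp [reassoc_of% hg]⟩)
    ((Abelian.Ext.mk₀ a'.hom).comp e (zero_add 1))
  rw [← Abelian.Ext.mk₀_id_comp e, ← a'.inv_hom_id, ← Abelian.Ext.mk₀_comp_mk₀_assoc, hz,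
    Abelian.Ext.comp_zero]

/-- The vanishing of `𝔼(X, Y)` passes to `𝔼(X, Z)` when `H⁰(Z)` is a quotient of `H⁰(Y)`. -/
lemma EVanishes.of_epi {X Y Z : K A} (h : EVanishes X Y) (hX : twoTerm A X)
    (hY : twoTerm A Y) (hZ : twoTerm A Z)
    (p : (HomotopyCategory.homologyFunctor (ModuleCat.{u} A) (.up ℤ) 0).obj Y ⟶
      (HomotopyCategory.homologyFunctor (ModuleCat.{u} A) (.up ℤ) 0).obj Z) [Epi p] :
    EVanishes X Z := by
  obtain ⟨P, hP, hP', ⟨i⟩⟩ := hX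
  obtain ⟨Q, hQ, hQ', ⟨j⟩⟩ := hY
  obtain ⟨R, hR, hR', ⟨k⟩⟩ := hZ
  have tP : IsTwoTermProjective P := ⟨fun i => (hP i).2, hP'⟩
  have tQ : IsTwoTermProjective Q := ⟨fun i => (hQ i).2, hQ'⟩
  have tR : IsTwoTermProjective R := ⟨fun i => (hR i).2, hR'⟩
  have := tP.projective
  have h' := (eVanishes_iff tP tQ).1 (h.of_iso i j)
  refine EVanishes.of_iso ((eVanishes_iff tP tR).2 fun φ => ?_) i.symm k.symm
  let p' := (HomotopyCategory.homologyFunctor (ModuleCat.{u} A) (.up ℤ) 0).map j.inv ≫ p ≫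
    (HomotopyCategory.homologyFunctor (ModuleCat.{u} A) (.up ℤ) 0).map k.hom
  -- Lift `φ` through the epimorphism `p'`, extend the lift to `P⁰`, then push forward again.
  obtain ⟨g, hg⟩ := h' (Projective.factorThru φ p')
  exact ⟨g ≫ p', by rw [reassoc_of% hg, Projective.factorThru_comp]⟩

/-! ### Passing from cotorsion pairs to modules -/

variable {U V : ObjectProperty (K A)}

lemma H0_le_isFG {W : ObjectProperty (K A)} (hW : W ≤ twoTerm A) : H0 W ≤ ModuleCat.isFG A := by
  rintro M ⟨X, hX, ⟨e⟩⟩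
  exact isFG_of_epi e.hom (isFG_H0 (hW _ hX))

/-- `H⁰(V)` is closed under quotients. -/
lemma IsCotorsionPair.H0_right_of_epi [IsNoetherianRing A]
    (h : IsCotorsionPair (twoTerm A) U V) {M N : ModuleCat.{u} A} (hM : H0 V M) (p : M ⟶ N)
    [Epi p] : H0 V N := by
  obtain ⟨P, hP, hP', ⟨e⟩⟩ := exists_presentation
    (isFG_of_epi p (H0_le_isFG h.right_le M hM))
  obtain ⟨X, hX, ⟨i⟩⟩ := hM
  have tP := twoTerm_quotient hP hP'
  -- Any presentation of `N` lies in `V`, since membership is tested by `𝔼(W, -)`, which sees only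
  -- `H⁰`.
  refine ⟨_, (h.right_iff _ tP).1 fun W hW => ?_, ⟨e⟩⟩
  exact EVanishes.of_epi ((h.right_iff X (h.right_le _ hX)).2 hX W hW) (h.left_le _ hW)
    (h.right_le _ hX) tP (i.hom ≫ p ≫ e.inv)

lemma IsCotorsionPair.ext_eq_zero (h : IsCotorsionPair (twoTerm A) U V) {M N : ModuleCat.{u} A}
    (hM : H0 U M) (hN : H0 V N) (e : Abelian.Ext M N 1) : e = 0 := by
  obtain ⟨X, hX, ⟨i⟩⟩ := hM
  obtain ⟨Y, hY, ⟨j⟩⟩ := hN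
  exact EVanishes.ext_eq_zero ((h.right_iff Y (h.right_le _ hY)).2 hY X hX) (h.left_le _ hX)
    (h.right_le _ hY) i j e

lemma exact_H0_map {X Y Z : K A} {f : X ⟶ Y} {g : Y ⟶ Z} {δ : Z ⟶ X⟦(1 : ℤ)⟧}
    (hT : Triangle.mk f g δ ∈ distTriang (K A)) :
    ∃ zero : (HomotopyCategory.homologyFunctor (ModuleCat.{u} A) (.up ℤ) 0).map f ≫
        (HomotopyCategory.homologyFunctor (ModuleCat.{u} A) (.up ℤ) 0).map g = 0,
      (ShortComplex.mk _ _ zero).Exact :=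
  ⟨_, (HomotopyCategory.homologyFunctor (ModuleCat.{u} A) (.up ℤ) 0).map_distinguished_exact _ hT⟩

/-- In a triangle `X ⟶ Y ⟶ Z ⟶ X[1]` with `X` two-term, `H⁰(Y) ⟶ H⁰(Z)` is an epimorphism. -/
lemma epi_H0_map {X Y Z : K A} (hX : twoTerm A X) {f : X ⟶ Y} {g : Y ⟶ Z} {δ : Z ⟶ X⟦(1 : ℤ)⟧}
    (hT : Triangle.mk f g δ ∈ distTriang (K A)) :
    Epi ((HomotopyCategory.homologyFunctor (ModuleCat.{u} A) (.up ℤ) 0).map g) := by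
  have := (HomotopyCategory.homologyFunctor (ModuleCat.{u} A) (.up ℤ) 0).map_distinguished_exact _
    (rot_of_distTriang _ hT)
  exact this.epi_f (hX.isZero_H0_shift.eq_of_tgt _ _)

/-- If `Ext¹(X, S₁) = 0`, morphisms from `X` lift along the epimorphism of `S`. -/
lemma exists_lift_of_ext_eq_zero {C : Type u} [Category.{v} C] [Abelian C] [HasExt.{w} C]
    {S : ShortComplex C} (hS : S.ShortExact) {X : C}
    (h : ∀ e : Abelian.Ext X S.X₁ 1, e = 0) (a : X ⟶ S.X₃) : ∃ b : X ⟶ S.X₂, b ≫ S.g = a := by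
  obtain ⟨x, hx⟩ := Abelian.Ext.covariant_sequence_exact₃ X hS (Abelian.Ext.mk₀ a) (zero_add 1)
    (h _)
  obtain ⟨b, rfl⟩ := Abelian.Ext.addEquiv₀.symm.surjective x
  refine ⟨b, ?_⟩
  apply Abelian.Ext.addEquiv₀.symm.injective
  simpa using hx

lemma IsCompleteCotorsionPair.isLeftWeakCotorsionPair_H0 [IsNoetherianRing A]
    (h : IsCompleteCotorsionPair (twoTerm A) U V) :
    IsLeftWeakCotorsionPair (H0 U) (H0 V) where
  left_le := H0_le_isFG h.left_le
  right_le := H0_le_isFG h.right_le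
  left_iso := by dsimp only [H0]; infer_instance
  right_iso := by dsimp only [H0]; infer_instance
  ext_eq_zero _ _ hX hY e := h.toIsCotorsionPair.ext_eq_zero hX hY e
  exists_right M hM := by
    obtain ⟨P, hP, hP', ⟨e⟩⟩ := exists_presentation hM
    have tP := twoTerm_quotient hP hP'
    rw [← h.cone_eq] at tP
    obtain ⟨-, V', U', f, g, δ, eV, -, hV', hU', hT⟩ := tP
    let F := HomotopyCategory.homologyFunctor (ModuleCat.{u} A) (.up ℤ) 0
    have hepi : Epi (F.map g) := epi_H0_map eV hT
    obtain ⟨hfg, hex⟩ := exact_H0_map hT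
    let p : F.obj U' ⟶ M := F.map g ≫ e.hom
    have hfp : F.map f ≫ p = 0 := by
      rw [← Category.assoc, hfg, zero_comp]
    have hex' : (ShortComplex.mk (F.map f) p hfp).Exact :=
      (ShortComplex.exact_iff_of_iso (ShortComplex.isoMk (S₁ := ShortComplex.mk _ _ hfg)
        (S₂ := ShortComplex.mk _ _ hfp) (Iso.refl _) (Iso.refl _) e (by simp [F])
        (by simp [p, F]))).1 hex
    -- By exactness the kernel of `p` is the image of `H⁰(V')`, so it is a quotient of an object of
    -- `H⁰(V)`.
    have hlift : Epi (kernel.lift p (F.map f) hfp) := hex'.epi_kernelLift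
    have hK : H0 V (kernel p) :=
      h.toIsCotorsionPair.H0_right_of_epi ⟨_, hV', ⟨Iso.refl _⟩⟩
        (kernel.lift p (F.map f) hfp)
    have hU : H0 U (F.obj U') := ⟨_, hU', ⟨Iso.refl _⟩⟩
    have hS : (ShortComplex.mk (kernel.ι p) p (kernel.condition p)).ShortExact :=
      { exact := ShortComplex.exact_of_f_is_kernel _ (kernelIsKernel p) }
    exact ⟨kernel p, F.obj U', kernel.ι p, p, kernel.condition p, hU, hK, hS, hU,
      fun X hX a => exists_lift_of_ext_eq_zero hS
        (fun e => h.toIsCotorsionPair.ext_eq_zero hX hK e) a⟩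
  exists_left M hM := by
    obtain ⟨P, hP, hP', ⟨e⟩⟩ := exists_presentation hM
    have tP := twoTerm_quotient hP hP'
    have tP' := tP
    rw [← h.cocone_eq] at tP
    obtain ⟨-, V', U', f, g, δ, -, -, hV', hU', hT⟩ := tP
    let F := HomotopyCategory.homologyFunctor (ModuleCat.{u} A) (.up ℤ) 0
    obtain ⟨hfg, hex⟩ := exact_H0_map hT
    have hV : H0 V (F.obj V') := ⟨_, hV', ⟨Iso.refl _⟩⟩
    have hzero : (e.inv ≫ F.map f) ≫ F.map g = 0 := by
      rw [Category.assoc, hfg, comp_zero]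
    have hex' : (ShortComplex.mk (e.inv ≫ F.map f) (F.map g) hzero).Exact :=
      (ShortComplex.exact_iff_of_iso (ShortComplex.isoMk (S₁ := ShortComplex.mk _ _ hfg)
        (S₂ := ShortComplex.mk _ _ hzero) e (Iso.refl _) (Iso.refl _) (by simp [F])
        (by simp [F]))).1 hex
    refine ⟨F.obj V', F.obj U', e.inv ≫ F.map f, F.map g, hzero, ⟨_, hU', ⟨Iso.refl _⟩⟩,
      hV, hex', epi_H0_map tP' hT, hV, ?_⟩
    rintro N ⟨Y, hY, ⟨i⟩⟩ a
    -- Fullness of `H⁰` moves the extension problem into the triangle, where `𝔼(U', Y) = 0` solves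
    -- it.
    obtain ⟨b, hb⟩ := tP'.exists_map_eq (h.right_le _ hY) (e.hom ≫ a ≫ i.inv)
    obtain ⟨c, hc⟩ :=
      ((h.right_iff Y (h.right_le _ hY)).2 hY U' hU').exists_extension hT b
    refine ⟨F.map c ≫ i.hom, ?_⟩
    rw [Category.assoc, ← F.map_comp_assoc, hc, hb]
    simp

end

end TwoTermCotorsion

theorem mainTheorem6 (k : Type w) [Field k] (A : Type u) [Ring A] [Algebra k A]
    [FiniteDimensional k A]
    (U V : CategoryTheory.ObjectProperty (TwoTermCotorsion.K A))
    (h : TwoTermCotorsion.IsCompleteCotorsionPair (TwoTermCotorsion.twoTerm A) U V) :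
    TwoTermCotorsion.IsLeftWeakCotorsionPair
      (TwoTermCotorsion.H0 U) (TwoTermCotorsion.H0 V) := by
  have : IsNoetherianRing A := isNoetherian_of_tower k inferInstance
  exact h.isLeftWeakCotorsionPair_H0
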